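/- Let $\mathbb H$ be the Heisenberg group, that is, $\mathbb R^3$ with the product $(x,y,z)\cdot(x',y',z')=\bigl(x+x',\,y+y',\,z+z'+\tfrac12(xy'-yx')\bigr)$, equipped with the Korányi distance $d(p,q)=|q^{-1}p|_K$, where $|(x,y,z)|_K=\bigl((x^2+y^2)^2+16z^2\bigr)^{1/4}$; $\dim_H$ is the Hausdorff dimension for $d$. For $\lambda>0$ a set $E\subset\mathbb H$ is a *$\lambda$-vertical curve* if $E\subset p\cdot\{(x,y,z): |z|\ge\lambda(x^2+y^2)\}$ for every $p\in E$. For $\phi\in\{1,-1\}$ and $r>0$, a curve $\beta:[0,1]\to\mathbb H$ arises from $\alpha:[0,1]\to\mathbb H$ by a *helical perturbation* of radius $r$ and orientation $\phi$ if $\beta(t)=\alpha(t)\,v(0)^{-1}v(\theta(t))$ for all $t\in[0,1]$, where $v(\theta)=(r\cos\theta,-\phi r\sin\theta,0)$ and $\theta$ is a smooth function with $\theta'>0$ on $[0,1]$, $\theta(0)=0$ and $\theta(1)\in2\pi\mathbb N$. **Theorem.** For every $\lambda>0$ there are connected non-empty $\lambda$-vertical curves $E,E'\subset\mathbb H$ with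 $$\dim_H(E)<2<\dim_H(E').$$ Moreover $E=\gamma([0,1])$ and $E'=\gamma'([0,1])$ for maps $\gamma,\gamma':[0,1]\to\mathbb H$ with the following properties. 1. *(Limits of helical perturbations.)* $\gamma$ is the uniform limit of a sequence of smooth curves $\alpha_i:[0,1]\to\mathbb H$, $i\ge0$, such that every $\alpha_i([0,1])$ is a $\lambda$-vertical curve, the $z$-component of the left-translated velocity $\frac{d}{dt}\bigl[\alpha_i(\tau)^{-1}\alpha_i(t)\bigr]_{t=\tau}$ is positive for all $i$ and all $\tau\in[0,1]$, and $\alpha_{i+1}$ arises from $\alpha_i$ by a helical perturbation of orientation $-1$ and radius $r_i$, where $r_0>r_1>\cdots>0$ and $r_i\to0$. The same holds for $\gamma'$ (with its own curves and radii) with orientation $+1$. 2. *(Bi-Hölder bounds.)* There are exponents $\tfrac12<a\le b<1$ and $0<a'\le b'<\tfrac12$ and a constant $C>0$ such that for all $s,t\in[0,1]$ $$C^{-1}|s-t|^{b}\le d(\gamma(s),\gamma(t))\le C|s-t|^{a},\qquad C^{-1}|s-t|^{b'}\le d(\gamma'(s),\gamma'(t))\le C|s-t|^{a'}.$$ -/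

import Mathlib

open Set Filter Topology
open scoped ContDiff

/-- The first Heisenberg group, identified with `ℝ³` by exponential coordinates `(x, y, z)`. -/
@[ext]
structure Heisenberg where
  x : ℝ
  y : ℝ
  z : ℝ

noncomputable section

namespace Heisenberg

/-- The product given by the Baker-Campbell-Hausdorff formula for the bracket `[X, Y] = Z`. -/
instance : Mul Heisenberg :=
  ⟨fun p q => ⟨p.x + q.x, p.y + q.y, p.z + q.z + (p.x * q.y - p.y * q.x) / 2⟩⟩

instance : One Heisenberg := ⟨⟨0, 0, 0⟩⟩

instance : Inv Heisenberg := ⟨fun p => ⟨-p.x, -p.y, -p.z⟩⟩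

@[simp] theorem mul_x (p q : Heisenberg) : (p * q).x = p.x + q.x := rfl
@[simp] theorem mul_y (p q : Heisenberg) : (p * q).y = p.y + q.y := rfl
@[simp] theorem mul_z (p q : Heisenberg) :
    (p * q).z = p.z + q.z + (p.x * q.y - p.y * q.x) / 2 := rfl
@[simp] theorem one_x : (1 : Heisenberg).x = 0 := rfl
@[simp] theorem one_y : (1 : Heisenberg).y = 0 := rfl
@[simp] theorem one_z : (1 : Heisenberg).z = 0 := rfl
@[simp] theorem inv_x (p : Heisenberg) : (p⁻¹).x = -p.x := rfl
@[simp] theorem inv_y (p : Heisenberg) : (p⁻¹).y = -p.y := rfl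
@[simp] theorem inv_z (p : Heisenberg) : (p⁻¹).z = -p.z := rfl

instance : Group Heisenberg where
  mul_assoc p q r := by ext <;> simp <;> ring
  one_mul p := by ext <;> simp
  mul_one p := by ext <;> simp
  inv_mul_cancel p := by ext <;> simp; ring

/-- The Korányi norm `((x² + y²)² + 16 z²)^(1/4)`. -/
def koranyi (p : Heisenberg) : ℝ :=
  √(√((p.x ^ 2 + p.y ^ 2) ^ 2 + 16 * p.z ^ 2))

theorem koranyi_nonneg (p : Heisenberg) : 0 ≤ koranyi p := Real.sqrt_nonneg _

theorem koranyi_sq (p : Heisenberg) :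
    koranyi p ^ 2 = ‖(⟨p.x ^ 2 + p.y ^ 2, 4 * p.z⟩ : ℂ)‖ := by
  rw [koranyi, Real.sq_sqrt (Real.sqrt_nonneg _), Complex.norm_eq_sqrt_sq_add_sq]
  congr 1
  ring

theorem norm_horizontal_le_koranyi (p : Heisenberg) : ‖(⟨p.x, p.y⟩ : ℂ)‖ ≤ koranyi p := by
  rw [Complex.norm_eq_sqrt_sq_add_sq, koranyi]
  apply Real.sqrt_le_sqrt
  apply Real.le_sqrt_of_sq_le
  nlinarith [sq_nonneg p.z]

theorem koranyi_mul_le (p q : Heisenberg) : koranyi (p * q) ≤ koranyi p + koranyi q := by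
  have hp := koranyi_nonneg p
  have hq := koranyi_nonneg q
  refine le_of_sq_le_sq ?_ (add_nonneg hp hq)
  have e : (⟨(p * q).x ^ 2 + (p * q).y ^ 2, 4 * (p * q).z⟩ : ℂ)
      = ⟨p.x ^ 2 + p.y ^ 2, 4 * p.z⟩ + ⟨q.x ^ 2 + q.y ^ 2, 4 * q.z⟩
        + 2 * ((starRingEnd ℂ) ⟨p.x, p.y⟩ * ⟨q.x, q.y⟩) := by
    apply Complex.ext <;> simp <;> ring
  rw [koranyi_sq, e]
  have h1 : ‖(2 * ((starRingEnd ℂ) ⟨p.x, p.y⟩ * ⟨q.x, q.y⟩) : ℂ)‖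
      ≤ 2 * (koranyi p * koranyi q) := by
    rw [norm_mul, norm_mul, RCLike.norm_conj, Complex.norm_ofNat]
    have := mul_le_mul (norm_horizontal_le_koranyi p) (norm_horizontal_le_koranyi q)
      (norm_nonneg _) hp
    linarith
  calc _ ≤ _ := norm_add₃_le
    _ ≤ koranyi p ^ 2 + koranyi q ^ 2 + 2 * (koranyi p * koranyi q) := by
        rw [koranyi_sq p, koranyi_sq q]; linarith
    _ = _ := by ring

theorem koranyi_inv (p : Heisenberg) : koranyi p⁻¹ = koranyi p := by
  simp [koranyi]

theorem koranyi_one : koranyi 1 = 0 := by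
  simp [koranyi]

theorem eq_one_of_koranyi_eq_zero {p : Heisenberg} (h : koranyi p = 0) : p = 1 := by
  have h2 := koranyi_sq p
  rw [h, zero_pow two_ne_zero, eq_comm, norm_eq_zero] at h2
  have hr := congrArg Complex.re h2
  have hi := congrArg Complex.im h2
  simp only [Complex.zero_re, Complex.zero_im] at hr hi
  ext <;> simp <;> nlinarith [sq_nonneg p.x, sq_nonneg p.y]

/-- The Heisenberg group carries the Korányi distance `d(p, q) = |q⁻¹ p|`; the topology and the
Hausdorff dimension are those of this metric. -/
instance : MetricSpace Heisenberg where
  dist p q := koranyi (q⁻¹ * p)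
  dist_self p := by
    change koranyi (p⁻¹ * p) = 0
    rw [inv_mul_cancel, koranyi_one]
  dist_comm p q := by
    change koranyi (q⁻¹ * p) = koranyi (p⁻¹ * q)
    rw [← koranyi_inv, mul_inv_rev, inv_inv]
  dist_triangle p q r := by
    change koranyi (r⁻¹ * p) ≤ koranyi (q⁻¹ * p) + koranyi (r⁻¹ * q)
    have h := koranyi_mul_le (r⁻¹ * q) (q⁻¹ * p)
    have e : r⁻¹ * q * (q⁻¹ * p) = r⁻¹ * p := by group
    rw [e] at h
    linarith
  eq_of_dist_eq_zero {p q} h := (inv_mul_eq_one.mp (eq_one_of_koranyi_eq_zero h)).symm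

theorem dist_def (p q : Heisenberg) : dist p q = koranyi (q⁻¹ * p) := rfl

/-- The homogeneous cone `|z| ≥ lam (x² + y²)` around the centre of the group. -/
def VCone (lam : ℝ) : Set Heisenberg := {p | lam * (p.x ^ 2 + p.y ^ 2) ≤ |p.z|}

/-- `E` is a `lam`-vertical curve: `E ⊆ p · VCone lam` for every `p ∈ E`. -/
def IsVerticalCurve (lam : ℝ) (E : Set Heisenberg) : Prop :=
  ∀ p ∈ E, E ⊆ (fun q => p * q) '' VCone lam

/-- A curve is smooth if its three coordinates are. -/
def IsSmooth (α : ℝ → Heisenberg) : Prop :=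
  ContDiff ℝ ∞ (fun t => (α t).x) ∧ ContDiff ℝ ∞ (fun t => (α t).y) ∧
    ContDiff ℝ ∞ (fun t => (α t).z)

/-- The `Z`-component of the velocity of `α` at `τ`, left-translated to the identity. A smooth curve
is tangent to the horizontal distribution at `τ` exactly when this is `0`. -/
def verticalSpeed (α : ℝ → Heisenberg) (τ : ℝ) : ℝ :=
  deriv (fun t => ((α τ)⁻¹ * α t).z) τ

/-- The point at angle `θ` on the circle of radius `r` about the identity in the horizontal plane
`z = 0`. The circle is traversed clockwise if `φ = 1` and anticlockwise if `φ = -1`. -/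
def circlePoint (r φ θ : ℝ) : Heisenberg := ⟨r * Real.cos θ, -φ * r * Real.sin θ, 0⟩

/-- `β` arises from the curve `α` on `[0, 1]` by a helical perturbation of radius `r` and
orientation `φ`: while the parameter runs along `α`, one multiplies on the right by a loop
`w = v(0)⁻¹ v(θ)` at the identity, where `v` is the circle of radius `r` and the angle `θ` is a
smooth increasing function that makes a whole number of turns. -/
def IsHelicalPerturbation (r φ : ℝ) (α β : ℝ → Heisenberg) : Prop :=
  ∃ θ : ℝ → ℝ, ContDiff ℝ ∞ θ ∧ (∀ t ∈ Icc (0 : ℝ) 1, 0 < deriv θ t) ∧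
    θ 0 = 0 ∧ (∃ N : ℕ, θ 1 = 2 * Real.pi * N) ∧
    ∀ t ∈ Icc (0 : ℝ) 1, β t = α t * ((circlePoint r φ 0)⁻¹ * circlePoint r φ (θ t))

/-- On `[0, 1]`, `γ` is the uniform limit of smooth `lam`-vertical curves with nowhere horizontal
tangents (positively oriented), each of which arises from the one before by a helical perturbation
of orientation `φ`, at radii that decrease strictly to `0`. -/
def IsHelicalLimit (lam φ : ℝ) (γ : ℝ → Heisenberg) : Prop :=
  ∃ (α : ℕ → ℝ → Heisenberg) (r : ℕ → ℝ),
    (∀ i, IsSmooth (α i)) ∧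
    (∀ i, ∀ t ∈ Icc (0 : ℝ) 1, 0 < verticalSpeed (α i) t) ∧
    (∀ i, IsVerticalCurve lam (α i '' Icc 0 1)) ∧
    (∀ i, 0 < r i) ∧ StrictAnti r ∧ Tendsto r atTop (𝓝 0) ∧
    (∀ i, IsHelicalPerturbation (r i) φ (α i) (α (i + 1))) ∧
    TendstoUniformlyOn α γ atTop (Icc 0 1)

/-- `γ` is bi-Hölder on `[0, 1]`, with exponent `a` in the upper and `b` in the lower bound. -/
def IsBiHolder (a b : ℝ) (γ : ℝ → Heisenberg) : Prop :=
  ∃ C : ℝ, 0 < C ∧ ∀ s ∈ Icc (0 : ℝ) 1, ∀ t ∈ Icc (0 : ℝ) 1,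
    C⁻¹ * |s - t| ^ b ≤ dist (γ s) (γ t) ∧ dist (γ s) (γ t) ≤ C * |s - t| ^ a

end Heisenberg

end

/-! The vertical speed of a curve is the contact form `dz - (x dy - y dx)/2` on its velocity. Its
integral, the vertical mass, replaces length: a nearly vertical piece of mass `m` has endpoints at
distance about `2√m`, so a vertical segment has dimension 2. A helix of radius `ρ` turning by about
`ε/ρ²` per unit of mass adds, with sign `φ`, the area swept by its circle. Mass is thereby
multiplied by a factor between `rateLo` and `rateHi`, both above 1 for `φ = 1` and both below 1 for
`φ = -1` (`verticalSpeed_helix`, `helixMass_succ`). The bounds `IsTame` survive when the radius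
shrinks by 50, so the step can be iterated.

For `s < t`, let `i` be the first level whose mass `m` between `s` and `t` reaches `K ρ²`, with `ρ =
r / 50 ^ i`. As earlier levels fall short, the squared horizontal displacement at level `i` is `O(ε²
K m)`; later helices move the endpoints by at most `3ρ`, which is small against `√m` for large `K`.
So all later displacements are central up to `σ m` (`displacement_of_le`). This gives the cone
condition and squared distance comparable to `m`, hence to `50 ^ (-2i)`. Up to constants, `t - s`
lies between the `-i`-th powers of `2500 * rateHi` and `2500 * rateLo`. Eliminating `i` gives Hölder
exponents `log 50 / log (2500 q)`, which exceed `1/2` exactly when `q < 1`; the dimension bounds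
follow from Hölder continuity of the curve and of its inverse. -/

noncomputable section

namespace Heisenberg

/-! ### Coordinates, topology and completeness -/

theorem sq_add_sq_le_koranyi_sq (p : Heisenberg) : p.x ^ 2 + p.y ^ 2 ≤ koranyi p ^ 2 := by
  rw [koranyi_sq]
  exact (le_abs_self _).trans (Complex.abs_re_le_norm ⟨p.x ^ 2 + p.y ^ 2, 4 * p.z⟩)

theorem four_mul_abs_z_le_koranyi_sq (p : Heisenberg) : 4 * |p.z| ≤ koranyi p ^ 2 := by
  rw [koranyi_sq]
  have h := Complex.abs_im_le_norm ⟨p.x ^ 2 + p.y ^ 2, 4 * p.z⟩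
  rwa [abs_mul, abs_of_pos (by norm_num : (0 : ℝ) < 4)] at h

theorem koranyi_sq_le (p : Heisenberg) : koranyi p ^ 2 ≤ p.x ^ 2 + p.y ^ 2 + 4 * |p.z| := by
  rw [koranyi_sq]
  have h := Complex.norm_le_abs_re_add_abs_im ⟨p.x ^ 2 + p.y ^ 2, 4 * p.z⟩
  rwa [abs_mul, abs_of_pos (by norm_num : (0 : ℝ) < 4),
    abs_of_nonneg (by positivity : 0 ≤ p.x ^ 2 + p.y ^ 2)] at h

theorem abs_x_le_koranyi (p : Heisenberg) : |p.x| ≤ koranyi p :=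
  abs_le_of_sq_le_sq (by nlinarith [sq_add_sq_le_koranyi_sq p]) (koranyi_nonneg p)

theorem abs_y_le_koranyi (p : Heisenberg) : |p.y| ≤ koranyi p :=
  abs_le_of_sq_le_sq (by nlinarith [sq_add_sq_le_koranyi_sq p]) (koranyi_nonneg p)

theorem abs_x_sub_le_dist (p q : Heisenberg) : |p.x - q.x| ≤ dist p q := by
  have h := abs_x_le_koranyi (q⁻¹ * p)
  rwa [← dist_def, mul_x, inv_x, neg_add_eq_sub] at h

theorem abs_y_sub_le_dist (p q : Heisenberg) : |p.y - q.y| ≤ dist p q := by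
  have h := abs_y_le_koranyi (q⁻¹ * p)
  rwa [← dist_def, mul_y, inv_y, neg_add_eq_sub] at h

theorem continuous_x : Continuous Heisenberg.x :=
  (LipschitzWith.of_dist_le' (K := 1) fun p q => by
    rw [one_mul]; exact abs_x_sub_le_dist p q).continuous

theorem continuous_y : Continuous Heisenberg.y :=
  (LipschitzWith.of_dist_le' (K := 1) fun p q => by
    rw [one_mul]; exact abs_y_sub_le_dist p q).continuous

/-- Left translation mixes `z` with the horizontal coordinates, so `z` is Lipschitz only locally.
The factor `|q.x| + |q.y|` is bounded along Cauchy sequences, which is what completeness needs. -/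
theorem abs_z_sub_le (p q : Heisenberg) :
    |p.z - q.z| ≤ dist p q ^ 2 / 4 + (|q.x| + |q.y|) * dist p q / 2 := by
  have h := four_mul_abs_z_le_koranyi_sq (q⁻¹ * p)
  rw [← dist_def] at h
  have e : p.z - q.z = (q⁻¹ * p).z + (q.x * (p.y - q.y) - q.y * (p.x - q.x)) / 2 := by
    simp; ring
  have hx : |q.y * (p.x - q.x)| ≤ |q.y| * dist p q := by
    rw [abs_mul]; exact mul_le_mul_of_nonneg_left (abs_x_sub_le_dist p q) (abs_nonneg _)
  have hy : |q.x * (p.y - q.y)| ≤ |q.x| * dist p q := by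
    rw [abs_mul]; exact mul_le_mul_of_nonneg_left (abs_y_sub_le_dist p q) (abs_nonneg _)
  rw [e]
  rw [abs_le] at hx hy ⊢
  have hz := abs_le.mp (le_refl |(q⁻¹ * p).z|)
  constructor <;> linarith

theorem tendsto_of_coords {ι : Type*} {l : Filter ι} {u : ι → Heisenberg} {p : Heisenberg}
    (hx : Tendsto (fun i => (u i).x) l (𝓝 p.x)) (hy : Tendsto (fun i => (u i).y) l (𝓝 p.y))
    (hz : Tendsto (fun i => (u i).z) l (𝓝 p.z)) : Tendsto u l (𝓝 p) := by
  rw [tendsto_iff_dist_tendsto_zero]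
  have hc : Continuous fun v : ℝ × ℝ × ℝ =>
      √(√(((v.1 - p.x) ^ 2 + (v.2.1 - p.y) ^ 2) ^ 2
        + 16 * (v.2.2 - p.z + (p.y * v.1 - p.x * v.2.1) / 2) ^ 2)) := by
    fun_prop
  have ht := (hc.tendsto (p.x, p.y, p.z)).comp (hx.prodMk_nhds (hy.prodMk_nhds hz))
  convert ht using 1
  · funext i
    simp only [dist_def, koranyi, Function.comp, mul_x, mul_y, mul_z, inv_x, inv_y, inv_z]
    ring_nf
  · simp [mul_comm]

theorem tendsto_z {ι : Type*} {l : Filter ι} {u : ι → Heisenberg} {p : Heisenberg}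
    (h : Tendsto u l (𝓝 p)) : Tendsto (fun i => (u i).z) l (𝓝 p.z) := by
  rw [tendsto_iff_dist_tendsto_zero] at h ⊢
  refine squeeze_zero (fun _ => dist_nonneg) (fun i => abs_z_sub_le (u i) p) ?_
  have := ((h.pow 2).div_const 4).add ((h.const_mul (|p.x| + |p.y|)).div_const 2)
  simpa using this

theorem continuous_z : Continuous Heisenberg.z :=
  continuous_iff_continuousAt.mpr fun _ => tendsto_z tendsto_id

instance : CompleteSpace Heisenberg := by
  refine Metric.complete_of_cauchySeq_tendsto fun u hu => ?_
  have hx : CauchySeq fun n => (u n).x :=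
    (LipschitzWith.of_dist_le' (K := 1) fun p q : Heisenberg => by
      rw [one_mul]; exact abs_x_sub_le_dist p q).cauchySeq_comp hu
  have hy : CauchySeq fun n => (u n).y :=
    (LipschitzWith.of_dist_le' (K := 1) fun p q : Heisenberg => by
      rw [one_mul]; exact abs_y_sub_le_dist p q).cauchySeq_comp hu
  obtain ⟨x, hx'⟩ := cauchySeq_tendsto_of_complete hx
  obtain ⟨y, hy'⟩ := cauchySeq_tendsto_of_complete hy
  obtain ⟨b, hb, hub, hb0⟩ := cauchySeq_iff_le_tendsto_0.mp hu
  obtain ⟨R, hR⟩ := (hx'.abs.add hy'.abs).bddAbove_range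
  have hR' : ∀ n, |(u n).x| + |(u n).y| ≤ R := fun n => hR ⟨n, rfl⟩
  have hz : CauchySeq fun n => (u n).z := by
    refine cauchySeq_iff_le_tendsto_0.mpr ⟨fun N => b N ^ 2 / 4 + R * b N / 2, fun N => ?_, ?_, ?_⟩
    · have : 0 ≤ R := le_trans (by positivity) (hR' 0)
      have := hb N
      positivity
    · intro n m N hn hm
      refine (abs_z_sub_le (u n) (u m)).trans ?_
      have h1 := hub n m N hn hm
      have h2 : (0 : ℝ) ≤ dist (u n) (u m) := dist_nonneg
      have h3 := hR' m
      have h4 : 0 ≤ |(u m).x| + |(u m).y| := by positivity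
      nlinarith [mul_le_mul h3 h1 h2 (h4.trans h3)]
    · simpa using ((hb0.pow 2).div_const 4).add ((hb0.const_mul R).div_const 2)
  obtain ⟨z, hz'⟩ := cauchySeq_tendsto_of_complete hz
  exact ⟨⟨x, y, z⟩, tendsto_of_coords hx' hy' hz'⟩

/-! ### Vertical curves and the cone -/

theorem inv_mem_VCone {lam : ℝ} {p : Heisenberg} (h : p ∈ VCone lam) : p⁻¹ ∈ VCone lam := by
  simpa [VCone] using h

theorem isVerticalCurve_iff {lam : ℝ} {E : Set Heisenberg} :
    IsVerticalCurve lam E ↔ ∀ p ∈ E, ∀ q ∈ E, p⁻¹ * q ∈ VCone lam := by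
  refine forall₂_congr fun p _ => ⟨fun h q hq => ?_, fun h q hq => ⟨_, h q hq, by simp⟩⟩
  obtain ⟨c, hc, rfl⟩ := h hq
  simpa using hc

theorem isVerticalCurve_image_of_lt {lam : ℝ} {α : ℝ → Heisenberg} {S : Set ℝ}
    (h : ∀ s ∈ S, ∀ t ∈ S, s < t → (α s)⁻¹ * α t ∈ VCone lam) : IsVerticalCurve lam (α '' S) := by
  rw [isVerticalCurve_iff]
  rintro _ ⟨s, hs, rfl⟩ _ ⟨t, ht, rfl⟩
  rcases lt_trichotomy s t with hst | rfl | hst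
  · exact h s hs t ht hst
  · simp [VCone]
  · simpa using inv_mem_VCone (h t ht s hs hst)

theorem isClosed_VCone (lam : ℝ) : IsClosed (VCone lam) :=
  isClosed_le (((continuous_x.pow 2).add (continuous_y.pow 2)).const_mul lam) continuous_z.abs

theorem tendsto_inv_mul {ι : Type*} {l : Filter ι} {u v : ι → Heisenberg} {p q : Heisenberg}
    (hu : Tendsto u l (𝓝 p)) (hv : Tendsto v l (𝓝 q)) :
    Tendsto (fun i => (u i)⁻¹ * v i) l (𝓝 (p⁻¹ * q)) := by
  have ux := (continuous_x.tendsto p).comp hu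
  have uy := (continuous_y.tendsto p).comp hu
  have uz := (continuous_z.tendsto p).comp hu
  have vx := (continuous_x.tendsto q).comp hv
  have vy := (continuous_y.tendsto q).comp hv
  have vz := (continuous_z.tendsto q).comp hv
  exact tendsto_of_coords (ux.neg.add vx) (uy.neg.add vy)
    ((uz.neg.add vz).add (((ux.neg.mul vy).sub (uy.neg.mul vx)).div_const 2))

/-- The effect on a group element `g` of right translations of the two points it joins. -/
theorem translate_bounds {g u v : Heisenberg} {r m a : ℝ} (hu : koranyi u ≤ 3 * r)
    (hv : koranyi v ≤ 3 * r) (hg : g.x ^ 2 + g.y ^ 2 ≤ a) (hz : |g.z - m| ≤ a) :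
    (u⁻¹ * g * v).x ^ 2 + (u⁻¹ * g * v).y ^ 2 ≤ 3 * a + 72 * r ^ 2 ∧
      |(u⁻¹ * g * v).z - m| ≤ 3 * a + 72 * r ^ 2 := by
  have hu2 : koranyi u ^ 2 ≤ 9 * r ^ 2 := by nlinarith [koranyi_nonneg u]
  have hv2 : koranyi v ^ 2 ≤ 9 * r ^ 2 := by nlinarith [koranyi_nonneg v]
  have u1 := sq_add_sq_le_koranyi_sq u
  have v1 := sq_add_sq_le_koranyi_sq v
  have u2 := four_mul_abs_z_le_koranyi_sq u
  have v2 := four_mul_abs_z_le_koranyi_sq v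
  have u3 := abs_le.mp (le_refl |u.z|)
  have v3 := abs_le.mp (le_refl |v.z|)
  rw [abs_le] at hz ⊢
  simp only [mul_x, mul_y, mul_z, inv_x, inv_y, inv_z]
  refine ⟨?_, ?_, ?_⟩
  -- The parallelogram law, used twice, gives `2a + 2 * 2 * (9 + 9) r²`; hence the constant 72.
  · nlinarith [sq_nonneg (u.x + v.x), sq_nonneg (u.y + v.y), sq_nonneg (g.x + u.x - v.x),
      sq_nonneg (g.y + u.y - v.y)]
  · nlinarith [sq_nonneg (u.x - g.y), sq_nonneg (u.y + g.x), sq_nonneg (v.x - g.y),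
      sq_nonneg (v.y + g.x), sq_nonneg (u.x - v.y), sq_nonneg (u.y + v.x)]
  · nlinarith [sq_nonneg (u.x + g.y), sq_nonneg (u.y - g.x), sq_nonneg (v.x + g.y),
      sq_nonneg (v.y - g.x), sq_nonneg (u.x + v.y), sq_nonneg (u.y - v.x)]

/-! ### Vertical speed and vertical mass -/

theorem verticalSpeed_eq {α : ℝ → Heisenberg} {t x' y' z' : ℝ}
    (hx : HasDerivAt (fun t => (α t).x) x' t) (hy : HasDerivAt (fun t => (α t).y) y' t)
    (hz : HasDerivAt (fun t => (α t).z) z' t) :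
    verticalSpeed α t = z' - ((α t).x * y' - (α t).y * x') / 2 := by
  have h : HasDerivAt (fun τ => ((α t)⁻¹ * α τ).z)
      (z' + (-(α t).x * y' - -(α t).y * x') / 2) t :=
    ((hz.const_add (-(α t).z))).add (((hy.const_mul (-(α t).x)).sub
      (hx.const_mul (-(α t).y))).div_const 2)
  rw [verticalSpeed, h.deriv]
  ring

namespace IsSmooth

variable {α : ℝ → Heisenberg}

theorem hasDerivAt_x (h : IsSmooth α) (t : ℝ) :
    HasDerivAt (fun t => (α t).x) (deriv (fun t => (α t).x) t) t :=
  (h.1.differentiable (by simp) t).hasDerivAt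

theorem hasDerivAt_y (h : IsSmooth α) (t : ℝ) :
    HasDerivAt (fun t => (α t).y) (deriv (fun t => (α t).y) t) t :=
  (h.2.1.differentiable (by simp) t).hasDerivAt

theorem hasDerivAt_z (h : IsSmooth α) (t : ℝ) :
    HasDerivAt (fun t => (α t).z) (deriv (fun t => (α t).z) t) t :=
  (h.2.2.differentiable (by simp) t).hasDerivAt

theorem verticalSpeed_eq (h : IsSmooth α) (t : ℝ) :
    verticalSpeed α t = deriv (fun t => (α t).z) t
      - ((α t).x * deriv (fun t => (α t).y) t - (α t).y * deriv (fun t => (α t).x) t) / 2 :=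
  Heisenberg.verticalSpeed_eq (h.hasDerivAt_x t) (h.hasDerivAt_y t) (h.hasDerivAt_z t)

theorem contDiff_verticalSpeed (h : IsSmooth α) : ContDiff ℝ ∞ (verticalSpeed α) := by
  rw [funext h.verticalSpeed_eq]
  have hx := (contDiff_infty_iff_deriv.mp h.1).2
  have hy := (contDiff_infty_iff_deriv.mp h.2.1).2
  have hz := (contDiff_infty_iff_deriv.mp h.2.2).2
  exact hz.sub (((h.1.mul hy).sub (h.2.1.mul hx)).div_const 2)

end IsSmooth

/-- The vertical measure of the curve `α` from parameter `0` to parameter `t`. -/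
def verticalMass (α : ℝ → Heisenberg) (t : ℝ) : ℝ := ∫ τ in (0 : ℝ)..t, verticalSpeed α τ

@[simp] theorem verticalMass_zero (α : ℝ → Heisenberg) : verticalMass α 0 = 0 :=
  intervalIntegral.integral_same

theorem IsSmooth.hasDerivAt_verticalMass {α : ℝ → Heisenberg} (h : IsSmooth α) (t : ℝ) :
    HasDerivAt (verticalMass α) (verticalSpeed α t) t :=
  intervalIntegral.integral_hasDerivAt_right
    (h.contDiff_verticalSpeed.continuous.intervalIntegrable _ _)
    (h.contDiff_verticalSpeed.continuous.stronglyMeasurableAtFilter _ _)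
    h.contDiff_verticalSpeed.continuous.continuousAt

theorem IsSmooth.contDiff_verticalMass {α : ℝ → Heisenberg} (h : IsSmooth α) :
    ContDiff ℝ ∞ (verticalMass α) := by
  rw [contDiff_infty_iff_deriv]
  refine ⟨fun t => (h.hasDerivAt_verticalMass t).differentiableAt, ?_⟩
  rw [funext fun t => (h.hasDerivAt_verticalMass t).deriv]
  exact h.contDiff_verticalSpeed

/-- A comparison form of the mean value inequality. -/
theorem abs_sub_le_of_abs_deriv_le {f g f' g' : ℝ → ℝ} {s t : ℝ} (hst : s ≤ t)
    (hf : ∀ τ, HasDerivAt f (f' τ) τ) (hg : ∀ τ, HasDerivAt g (g' τ) τ)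
    (h : ∀ τ, s ≤ τ → |f' τ| ≤ g' τ) : |f t - f s| ≤ g t - g s := by
  have mono {e e' : ℝ → ℝ} (he : ∀ τ, HasDerivAt e (e' τ) τ) (h0 : ∀ τ, s ≤ τ → 0 ≤ e' τ) :
      e s ≤ e t := by
    refine monotoneOn_of_deriv_nonneg (convex_Ici s)
      (fun τ _ => (he τ).continuousAt.continuousWithinAt)
      (fun τ _ => (he τ).differentiableAt.differentiableWithinAt) (fun τ hτ => ?_)
      self_mem_Ici hst hst
    rw [(he τ).deriv]
    exact h0 τ (interior_subset hτ)
  have h1 := mono (fun τ => (hg τ).sub (hf τ)) fun τ hτ => by linarith [(abs_le.mp (h τ hτ)).2]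
  have h2 := mono (fun τ => (hg τ).add (hf τ)) fun τ hτ => by linarith [(abs_le.mp (h τ hτ)).1]
  simp only [Pi.sub_apply, Pi.add_apply] at h1 h2
  rw [abs_le]
  constructor <;> linarith

/-! ### Winding a circle around a curve -/

/-- The displacement from angle `0` to angle `θ` along a horizontal circle. -/
def circleStep (r φ θ : ℝ) : Heisenberg := (circlePoint r φ 0)⁻¹ * circlePoint r φ θ

theorem koranyi_circlePoint_le {r φ : ℝ} (hr : 0 ≤ r) (hφ : φ ^ 2 = 1) (θ : ℝ) :
    koranyi (circlePoint r φ θ) ≤ r := by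
  refine le_of_sq_le_sq ((koranyi_sq_le _).trans (le_of_eq ?_)) hr
  simp only [circlePoint, abs_zero]
  linear_combination r ^ 2 * Real.sin_sq_add_cos_sq θ + r ^ 2 * Real.sin θ ^ 2 * hφ

theorem koranyi_circleStep_le {r φ : ℝ} (hr : 0 ≤ r) (hφ : φ ^ 2 = 1) (θ : ℝ) :
    koranyi (circleStep r φ θ) ≤ 2 * r := by
  have h0 := koranyi_circlePoint_le hr hφ 0
  have h1 := koranyi_circlePoint_le hr hφ θ
  have := koranyi_mul_le (circlePoint r φ 0)⁻¹ (circlePoint r φ θ)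
  rw [koranyi_inv] at this
  unfold circleStep
  linarith

section perturb

variable {α : ℝ → Heisenberg} {θ : ℝ → ℝ} {r φ t θ' x' y' z' : ℝ}

theorem mul_circleStep_x (p : Heisenberg) (r φ θ : ℝ) :
    (p * circleStep r φ θ).x = p.x + (r * Real.cos θ - r) := by
  simp [circleStep, circlePoint]; ring

theorem mul_circleStep_y (p : Heisenberg) (r φ θ : ℝ) :
    (p * circleStep r φ θ).y = p.y - φ * r * Real.sin θ := by
  simp [circleStep, circlePoint]; ring

theorem mul_circleStep_z (p : Heisenberg) (r φ θ : ℝ) :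
    (p * circleStep r φ θ).z = p.z + (φ * r ^ 2 * Real.sin θ - p.x * (φ * r * Real.sin θ)
      - p.y * (r * Real.cos θ - r)) / 2 := by
  simp [circleStep, circlePoint]; ring

theorem hasDerivAt_mul_circleStep_x (hx : HasDerivAt (fun t => (α t).x) x' t)
    (hθ : HasDerivAt θ θ' t) :
    HasDerivAt (fun t => (α t * circleStep r φ (θ t)).x) (x' - r * θ' * Real.sin (θ t)) t := by
  simp only [mul_circleStep_x]
  exact (hx.add ((hθ.cos.const_mul r).sub_const r)).congr_deriv (by ring)

theorem hasDerivAt_mul_circleStep_y (hy : HasDerivAt (fun t => (α t).y) y' t)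
    (hθ : HasDerivAt θ θ' t) :
    HasDerivAt (fun t => (α t * circleStep r φ (θ t)).y)
      (y' - φ * r * θ' * Real.cos (θ t)) t := by
  simp only [mul_circleStep_y]
  exact (hy.sub (hθ.sin.const_mul (φ * r))).congr_deriv (by ring)

/-- Three contributions: the speed of `α`, the area swept by the circle at rate `r² θ' / 2` with
sign `φ`, and the commutator of the horizontal velocity of `α` with the circle step. -/
theorem verticalSpeed_mul_circleStep (hx : HasDerivAt (fun t => (α t).x) x' t)
    (hy : HasDerivAt (fun t => (α t).y) y' t) (hz : HasDerivAt (fun t => (α t).z) z' t)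
    (hθ : HasDerivAt θ θ' t) :
    verticalSpeed (fun t => α t * circleStep r φ (θ t)) t = verticalSpeed α t
      + φ * r ^ 2 * θ' / 2
      - (x' * (φ * r * Real.sin (θ t)) + y' * (r * Real.cos (θ t) - r)) := by
  have hz' := (hz.add ((((hθ.sin.const_mul (φ * r ^ 2)).sub
    (hx.mul (hθ.sin.const_mul (φ * r)))).sub
    (hy.mul ((hθ.cos.const_mul r).sub_const r))).div_const 2)).congr_of_eventuallyEq
    (.of_forall fun τ => mul_circleStep_z (α τ) r φ (θ τ))
  rw [verticalSpeed_eq hx hy hz, verticalSpeed_eq (hasDerivAt_mul_circleStep_x hx hθ)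
    (hasDerivAt_mul_circleStep_y hy hθ) hz', mul_circleStep_x, mul_circleStep_y]
  linear_combination (φ * r ^ 2 * θ' / 2) * Real.sin_sq_add_cos_sq (θ t)

theorem IsSmooth.mul_circleStep (h : IsSmooth α) (hθ : ContDiff ℝ ∞ θ) (r φ : ℝ) :
    IsSmooth fun t => α t * circleStep r φ (θ t) := by
  obtain ⟨hx, hy, hz⟩ := h
  have hs := hθ.sin
  have hc := hθ.cos
  refine ⟨?_, ?_, ?_⟩
  · simp only [mul_circleStep_x]
    exact hx.add ((contDiff_const.mul hc).sub contDiff_const)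
  · simp only [mul_circleStep_y]
    exact hy.sub (contDiff_const.mul hs)
  · simp only [mul_circleStep_z]
    exact hz.add ((((contDiff_const.mul hs).sub (hx.mul (contDiff_const.mul hs))).sub
      (hy.mul ((contDiff_const.mul hc).sub contDiff_const))).div_const 2)

end perturb

/-! ### One helix: constant turning rate per unit of mass -/

/-- The number of turns of the helix of radius `r` around `α`. -/
def helixTurns (r ε : ℝ) (α : ℝ → Heisenberg) : ℕ :=
  ⌈ε * verticalMass α 1 / (2 * Real.pi * r ^ 2)⌉₊

/-- The rate, per unit of vertical mass, at which the helix of radius `r` turns around `α`. -/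
def helixRate (r ε : ℝ) (α : ℝ → Heisenberg) : ℝ :=
  2 * Real.pi * helixTurns r ε α / verticalMass α 1

/-- The helix of radius `r` around `α` whose angle is proportional to the vertical mass of `α`. -/
def helix (r φ ε : ℝ) (α : ℝ → Heisenberg) (t : ℝ) : Heisenberg :=
  α t * circleStep r φ (helixRate r ε α * verticalMass α t)

/-- Control of the velocity of a curve at scales below `r`. -/
structure IsTame (r ε : ℝ) (α : ℝ → Heisenberg) : Prop where
  smooth : IsSmooth α
  speed_pos : ∀ t, 0 < verticalSpeed α t
  abs_deriv_x_le : ∀ t, |deriv (fun t => (α t).x) t| ≤ ε / (12 * r) * verticalSpeed α t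
  abs_deriv_y_le : ∀ t, |deriv (fun t => (α t).y) t| ≤ ε / (12 * r) * verticalSpeed α t
  radius_le : ∀ t, 7 * r ^ 2 ≤ ε * verticalSpeed α t

namespace IsTame

variable {r φ ε : ℝ} {α : ℝ → Heisenberg}

theorem radius_sq_le_mass (h : IsTame r ε α) : 7 * r ^ 2 ≤ ε * verticalMass α 1 := by
  have := abs_sub_le_of_abs_deriv_le (f := fun t => 7 * r ^ 2 * t)
    (g := fun t => ε * verticalMass α t) (f' := fun _ => 7 * r ^ 2)
    (g' := fun t => ε * verticalSpeed α t) (zero_le_one' ℝ)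
    (fun t => ((hasDerivAt_id t).const_mul (7 * r ^ 2)).congr_deriv (mul_one _))
    (fun t => (h.smooth.hasDerivAt_verticalMass t).const_mul ε)
    (fun t _ => by rw [abs_of_nonneg (by positivity)]; exact h.radius_le t)
  simp only [verticalMass_zero] at this
  linarith [le_abs_self (7 * r ^ 2 * 1 - 7 * r ^ 2 * 0)]

theorem mass_one_pos (h : IsTame r ε α) (hr : 0 < r) (hε : 0 < ε) : 0 < verticalMass α 1 :=
  pos_of_mul_pos_right (lt_of_lt_of_le (by positivity) h.radius_sq_le_mass) hε.le

/-- Without rounding, the rate times `r²` would be exactly `ε`. The unrounded number of turns `A` is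
at least 1, so rounding up at most doubles it. -/
theorem helixRate_bounds (h : IsTame r ε α) (hr : 0 < r) (hε : 0 < ε) :
    ε ≤ helixRate r ε α * r ^ 2 ∧ helixRate r ε α * r ^ 2 ≤ 2 * ε := by
  have hm := h.mass_one_pos hr hε
  have hπ := Real.pi_pos
  set A := ε * verticalMass α 1 / (2 * Real.pi * r ^ 2) with hA
  -- This is where the 7 in `radius_le` is used: `2π < 7`.
  have hA1 : 1 ≤ A := by
    rw [hA, one_le_div (by positivity)]
    have := h.radius_sq_le_mass
    have := Real.pi_lt_d2
    nlinarith [sq_nonneg r]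
  have h1 : A ≤ helixTurns r ε α := Nat.le_ceil _
  have h2 : (helixTurns r ε α : ℝ) < A + 1 := Nat.ceil_lt_add_one (by positivity)
  have e1 : helixRate r ε α * r ^ 2
      = helixTurns r ε α * (2 * Real.pi * r ^ 2 / verticalMass α 1) := by
    rw [helixRate]; ring
  have e2 : A * (2 * Real.pi * r ^ 2 / verticalMass α 1) = ε := by
    rw [hA]; field_simp
  have hc : 0 < 2 * Real.pi * r ^ 2 / verticalMass α 1 := by positivity
  rw [e1]
  constructor <;> nlinarith

/-- The circle step has `y`-component at most `r` and `x`-component at most `2r`, so tameness bounds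
the two commutator terms by `ε/12` and `ε/6` of the speed, together `ε/4`. -/
theorem verticalSpeed_helix (h : IsTame r ε α) (hr : 0 < r) (hφ : φ = 1 ∨ φ = -1) (t : ℝ) :
    |verticalSpeed (helix r φ ε α) t
      - (1 + φ * (helixRate r ε α * r ^ 2) / 2) * verticalSpeed α t| ≤
      ε / 4 * verticalSpeed α t := by
  have hx := h.abs_deriv_x_le t
  have hy := h.abs_deriv_y_le t
  have e := verticalSpeed_mul_circleStep (r := r) (φ := φ) (h.smooth.hasDerivAt_x t)
    (h.smooth.hasDerivAt_y t) (h.smooth.hasDerivAt_z t)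
    ((h.smooth.hasDerivAt_verticalMass t).const_mul (helixRate r ε α))
  change verticalSpeed (helix r φ ε α) t = _ at e
  rw [e]
  set a := deriv (fun t => (α t).x) t
  set b := deriv (fun t => (α t).y) t
  set θ := helixRate r ε α * verticalMass α t
  set w := verticalSpeed α t
  have ha : |a * (φ * r * Real.sin θ)| ≤ ε / 12 * w := by
    have : |φ * r * Real.sin θ| ≤ r := by
      rw [abs_mul, abs_mul, abs_of_pos hr]
      have : |φ| = 1 := by rcases hφ with rfl | rfl <;> simp
      rw [this]
      nlinarith [Real.abs_sin_le_one θ]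
    rw [abs_mul]
    calc _ ≤ ε / (12 * r) * w * r := mul_le_mul hx this (abs_nonneg _) ((abs_nonneg _).trans hx)
      _ = _ := by field_simp
  have hb : |b * (r * Real.cos θ - r)| ≤ ε / 6 * w := by
    have : |r * Real.cos θ - r| ≤ 2 * r := by
      rw [abs_le]
      constructor <;> nlinarith [Real.cos_le_one θ, Real.neg_one_le_cos θ]
    rw [abs_mul]
    calc _ ≤ ε / (12 * r) * w * (2 * r) :=
          mul_le_mul hy this (abs_nonneg _) ((abs_nonneg _).trans hy)
      _ = _ := by field_simp; ring
  rw [abs_le] at ha hb ⊢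
  constructor <;> linarith

theorem half_le_verticalSpeed_helix (h : IsTame r ε α) (hr : 0 < r) (hφ : φ = 1 ∨ φ = -1)
    (hε : 0 < ε) (hε' : ε ≤ 1 / 10) (t : ℝ) :
    verticalSpeed α t / 2 ≤ verticalSpeed (helix r φ ε α) t := by
  have h1 := (abs_le.mp (h.verticalSpeed_helix hr hφ t)).1
  obtain ⟨h2, h3⟩ := h.helixRate_bounds hr hε
  have hw := h.speed_pos t
  rcases hφ with rfl | rfl <;> nlinarith

/-- The helix adds horizontal speed at most `2ε/r` per unit of old vertical speed and keeps at least
half of that vertical speed. Shrinking the radius by 50 absorbs both losses. -/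
theorem helix (h : IsTame r ε α) (hr : 0 < r) (hφ : φ = 1 ∨ φ = -1) (hε : 0 < ε)
    (hε' : ε ≤ 1 / 10) : IsTame (r / 50) ε (helix r φ ε α) := by
  have hφ1 : |φ| = 1 := by rcases hφ with rfl | rfl <;> simp
  have hhalf := h.half_le_verticalSpeed_helix hr hφ hε hε'
  obtain ⟨h2, h3⟩ := h.helixRate_bounds hr hε
  have hκ : 0 < helixRate r ε α := pos_of_mul_pos_left (hε.trans_le h2) (sq_nonneg r)
  have hθ := fun t => (h.smooth.hasDerivAt_verticalMass t).const_mul (helixRate r ε α)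
  have key : ∀ t d c : ℝ, |d| ≤ ε / (12 * r) * verticalSpeed α t → |c| ≤ 1 →
      |d - r * (helixRate r ε α * verticalSpeed α t) * c| ≤
        ε / (12 * (r / 50)) * verticalSpeed (Heisenberg.helix r φ ε α) t := by
    intro t d c hd hc
    have hw := h.speed_pos t
    have e1 : r * (helixRate r ε α * verticalSpeed α t)
        = helixRate r ε α * r ^ 2 / r * verticalSpeed α t := by field_simp
    have e2 : helixRate r ε α * r ^ 2 / r ≤ 2 * ε / r := by gcongr
    calc _ ≤ |d| + |r * (helixRate r ε α * verticalSpeed α t) * c| := abs_sub _ _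
      _ ≤ ε / (12 * r) * verticalSpeed α t + 2 * ε / r * verticalSpeed α t := by
          have hp : 0 ≤ r * (helixRate r ε α * verticalSpeed α t) := by positivity
          rw [abs_mul, abs_of_nonneg hp, e1]
          have : helixRate r ε α * r ^ 2 / r * verticalSpeed α t * |c| ≤
              2 * ε / r * verticalSpeed α t * 1 := by gcongr
          linarith
      -- The ratio 50 solves `1/12 + 2 = (50/12) * (1/2)`.
      _ = ε / (12 * (r / 50)) * (verticalSpeed α t / 2) := by field_simp; norm_num
      _ ≤ _ := by gcongr; exact hhalf t
  refine ⟨h.smooth.mul_circleStep (contDiff_const.mul h.smooth.contDiff_verticalMass) r φ,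
    fun t => (half_pos (h.speed_pos t)).trans_le (hhalf t), fun t => ?_, fun t => ?_, fun t => ?_⟩
  · have e := (hasDerivAt_mul_circleStep_x (r := r) (φ := φ) (h.smooth.hasDerivAt_x t) (hθ t)).deriv
    change deriv (fun t => (Heisenberg.helix r φ ε α t).x) t = _ at e
    rw [e]
    exact key t _ _ (h.abs_deriv_x_le t) (Real.abs_sin_le_one _)
  · have e := (hasDerivAt_mul_circleStep_y (r := r) (φ := φ) (h.smooth.hasDerivAt_y t) (hθ t)).deriv
    change deriv (fun t => (Heisenberg.helix r φ ε α t).y) t = _ at e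
    rw [e, show ∀ c, φ * r * (helixRate r ε α * verticalSpeed α t) * c
      = r * (helixRate r ε α * verticalSpeed α t) * (φ * c) from fun c => by ring]
    refine key t _ _ (h.abs_deriv_y_le t) ?_
    rw [abs_mul, hφ1, one_mul]
    exact Real.abs_cos_le_one _
  · have h5 := h.radius_le t
    have h6 := mul_le_mul_of_nonneg_left (hhalf t) hε.le
    nlinarith [sq_nonneg r]

theorem isHelicalPerturbation_helix (h : IsTame r ε α) (hr : 0 < r) (hε : 0 < ε) (φ : ℝ) :
    IsHelicalPerturbation r φ α (Heisenberg.helix r φ ε α) := by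
  have hκ : 0 < helixRate r ε α :=
    pos_of_mul_pos_left (hε.trans_le (h.helixRate_bounds hr hε).1) (sq_nonneg r)
  refine ⟨fun t => helixRate r ε α * verticalMass α t,
    contDiff_const.mul h.smooth.contDiff_verticalMass, fun t _ => ?_, by simp,
    ⟨helixTurns r ε α, div_mul_cancel₀ _ (h.mass_one_pos hr hε).ne'⟩, fun t _ => rfl⟩
  rw [((h.smooth.hasDerivAt_verticalMass t).const_mul (helixRate r ε α)).deriv]
  exact mul_pos hκ (h.speed_pos t)

/-- Over a vertical mass `m`, the displacement of a tame curve is close to `m` times the centre. -/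
theorem displacement (h : IsTame r ε α) {s t : ℝ} (hst : s ≤ t) :
    |((α s)⁻¹ * α t).x| ≤ ε / (12 * r) * (verticalMass α t - verticalMass α s) ∧
    |((α s)⁻¹ * α t).y| ≤ ε / (12 * r) * (verticalMass α t - verticalMass α s) ∧
    |((α s)⁻¹ * α t).z - (verticalMass α t - verticalMass α s)| ≤
      (ε / (12 * r)) ^ 2 * (verticalMass α t - verticalMass α s) ^ 2 / 2 := by
  set D := ε / (12 * r)
  have hD := fun τ => (h.smooth.hasDerivAt_verticalMass τ).const_mul D
  have hx : ∀ τ, s ≤ τ → |(α τ).x - (α s).x| ≤ D * (verticalMass α τ - verticalMass α s) := by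
    intro τ hτ
    rw [mul_sub]
    exact abs_sub_le_of_abs_deriv_le hτ h.smooth.hasDerivAt_x hD fun τ _ => h.abs_deriv_x_le τ
  have hy : ∀ τ, s ≤ τ → |(α τ).y - (α s).y| ≤ D * (verticalMass α τ - verticalMass α s) := by
    intro τ hτ
    rw [mul_sub]
    exact abs_sub_le_of_abs_deriv_le hτ h.smooth.hasDerivAt_y hD fun τ _ => h.abs_deriv_y_le τ
  refine ⟨by simpa [neg_add_eq_sub] using hx t hst, by simpa [neg_add_eq_sub] using hy t hst, ?_⟩
  -- The central coordinate differs from the mass by the area swept by the horizontal projection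
  -- seen from its position at `s`, hence by a term quadratic in the mass.
  have hz : ∀ τ, HasDerivAt (fun τ => ((α s)⁻¹ * α τ).z - verticalMass α τ)
      ((((α τ).x - (α s).x) * deriv (fun t => (α t).y) τ
        - ((α τ).y - (α s).y) * deriv (fun t => (α t).x) τ) / 2) τ := by
    intro τ
    have h1 := (((h.smooth.hasDerivAt_z τ).const_add (-(α s).z)).add
      ((((h.smooth.hasDerivAt_y τ).const_mul (-(α s).x)).sub
      ((h.smooth.hasDerivAt_x τ).const_mul (-(α s).y))).div_const 2)).sub
      (h.smooth.hasDerivAt_verticalMass τ)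
    refine h1.congr_deriv ?_
    rw [h.smooth.verticalSpeed_eq]
    ring
  have hg : ∀ τ, HasDerivAt (fun τ => D ^ 2 * (verticalMass α τ - verticalMass α s) ^ 2 / 2)
      (D ^ 2 * (verticalMass α τ - verticalMass α s) * verticalSpeed α τ) τ := fun τ =>
    (((((h.smooth.hasDerivAt_verticalMass τ).sub_const _).pow 2).const_mul (D ^ 2)).div_const
      2).congr_deriv (by simp; ring)
  have := abs_sub_le_of_abs_deriv_le hst hz hg fun τ hτ => ?_
  · convert this using 1
    · congr 1
      simp
      ring
    · ring
  · have e1 : |((α τ).x - (α s).x) * deriv (fun t => (α t).y) τ| ≤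
        D * (verticalMass α τ - verticalMass α s) * (D * verticalSpeed α τ) := by
      rw [abs_mul]
      exact mul_le_mul (hx τ hτ) (h.abs_deriv_y_le τ) (abs_nonneg _)
        ((abs_nonneg _).trans (hx τ hτ))
    have e2 : |((α τ).y - (α s).y) * deriv (fun t => (α t).x) τ| ≤
        D * (verticalMass α τ - verticalMass α s) * (D * verticalSpeed α τ) := by
      rw [abs_mul]
      exact mul_le_mul (hy τ hτ) (h.abs_deriv_x_le τ) (abs_nonneg _)
        ((abs_nonneg _).trans (hy τ hτ))
    rw [abs_le] at e1 e2 ⊢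
    constructor <;> linarith

end IsTame

/-! ### Iterated helices and growth of mass -/

/-- The iterated helices around the vertical segment, of radii `r / 50 ^ n`. -/
def helixSeq (r φ ε : ℝ) : ℕ → ℝ → Heisenberg
  | 0 => fun t => ⟨0, 0, t⟩
  | n + 1 => helix (r / 50 ^ n) φ ε (helixSeq r φ ε n)

theorem isSmooth_helixSeq_zero (r φ ε : ℝ) : IsSmooth (helixSeq r φ ε 0) :=
  ⟨contDiff_const, contDiff_const, contDiff_id⟩

theorem verticalSpeed_helixSeq_zero (r φ ε t : ℝ) : verticalSpeed (helixSeq r φ ε 0) t = 1 := by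
  rw [(isSmooth_helixSeq_zero r φ ε).verticalSpeed_eq]
  simp [helixSeq]

/-- The vertical mass of the `n`-th iterated helix between two parameters. -/
def helixMass (r φ ε : ℝ) (n : ℕ) (s t : ℝ) : ℝ :=
  verticalMass (helixSeq r φ ε n) t - verticalMass (helixSeq r φ ε n) s

/-- The least factor by which a helix changes the vertical speed. -/
def rateLo (φ ε : ℝ) : ℝ := 1 + 3 * φ * ε / 4 - ε / 2

/-- The greatest factor by which a helix changes the vertical speed. -/
def rateHi (φ ε : ℝ) : ℝ := 1 + 3 * φ * ε / 4 + ε / 2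

/-- Admissible initial radius, orientation and pitch of an iterated helix. -/
structure HelixParams (r φ ε : ℝ) : Prop where
  r_pos : 0 < r
  orientation : φ = 1 ∨ φ = -1
  ε_pos : 0 < ε
  ε_le : ε ≤ 1 / 10
  radius_le : 7 * r ^ 2 ≤ ε

namespace HelixParams

variable {r φ ε : ℝ}

theorem half_le_rateLo (h : HelixParams r φ ε) : 1 / 2 ≤ rateLo φ ε := by
  have := h.ε_pos
  have := h.ε_le
  unfold rateLo
  rcases h.orientation with rfl | rfl <;> linarith

theorem rateLo_le_rateHi (h : HelixParams r φ ε) : rateLo φ ε ≤ rateHi φ ε := by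
  have := h.ε_pos
  unfold rateLo rateHi
  linarith

theorem rateHi_le_two (h : HelixParams r φ ε) : rateHi φ ε ≤ 2 := by
  have := h.ε_pos
  have := h.ε_le
  unfold rateHi
  rcases h.orientation with rfl | rfl <;> linarith

theorem rateHi_pos (h : HelixParams r φ ε) : 0 < rateHi φ ε := by
  linarith [h.half_le_rateLo, h.rateLo_le_rateHi]

theorem radius_pos (h : HelixParams r φ ε) (n : ℕ) : 0 < r / 50 ^ n := by
  have := h.r_pos
  positivity

theorem isTame (h : HelixParams r φ ε) : ∀ n, IsTame (r / 50 ^ n) ε (helixSeq r φ ε n)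
  | 0 => by
    have hr := h.r_pos
    have hε := h.ε_pos
    have hv := verticalSpeed_helixSeq_zero r φ ε
    refine ⟨isSmooth_helixSeq_zero r φ ε, fun t => ?_, fun t => ?_, fun t => ?_, fun t => ?_⟩
    · rw [hv]; exact one_pos
    · rw [hv]; simp only [helixSeq, deriv_const', abs_zero]; positivity
    · rw [hv]; simp only [helixSeq, deriv_const', abs_zero]; positivity
    · rw [hv]; simpa using h.radius_le
  | n + 1 => by
    have := (h.isTame n).helix (h.radius_pos n) h.orientation h.ε_pos h.ε_le
    rw [pow_succ, ← div_div]
    exact this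

theorem helixMass_zero (r φ ε s t : ℝ) : helixMass r φ ε 0 s t = t - s := by
  simp [helixMass, verticalMass, verticalSpeed_helixSeq_zero]

/-- The swept area contributes `φ` times a number in `[ε/2, ε]`, within `ε/4` of `3φε/4`; the
commutator error adds another `ε/4`. -/
theorem helixMass_succ (h : HelixParams r φ ε) (n : ℕ) {s t : ℝ} (hst : s ≤ t) :
    rateLo φ ε * helixMass r φ ε n s t ≤ helixMass r φ ε (n + 1) s t ∧
      helixMass r φ ε (n + 1) s t ≤ rateHi φ ε * helixMass r φ ε n s t := by
  have hn := fun τ => (h.isTame n).smooth.hasDerivAt_verticalMass τ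
  have hn' := fun τ => (h.isTame (n + 1)).smooth.hasDerivAt_verticalMass τ
  have key := abs_sub_le_of_abs_deriv_le hst
    (fun τ => (hn' τ).sub ((hn τ).const_mul (1 + 3 * φ * ε / 4)))
    (fun τ => (hn τ).const_mul (ε / 2)) fun τ _ => ?_
  · simp only [Pi.sub_apply] at key
    rw [abs_le] at key
    unfold helixMass rateLo rateHi
    constructor <;> linarith
  · have hw := (h.isTame n).speed_pos τ
    have h1 := (h.isTame n).verticalSpeed_helix (h.radius_pos n) h.orientation τ
    obtain ⟨h2, h3⟩ := (h.isTame n).helixRate_bounds (h.radius_pos n) h.ε_pos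
    change |verticalSpeed (helixSeq r φ ε (n + 1)) τ - _| ≤ _ at h1
    set e := helixRate (r / 50 ^ n) ε (helixSeq r φ ε n) * (r / 50 ^ n) ^ 2
    have h4 := mul_le_mul_of_nonneg_right h2 hw.le
    have h5 := mul_le_mul_of_nonneg_right h3 hw.le
    rw [abs_le] at h1 ⊢
    rcases h.orientation with rfl | rfl <;> constructor <;> linarith

theorem helixMass_bounds (h : HelixParams r φ ε) (n : ℕ) {s t : ℝ} (hst : s ≤ t) :
    rateLo φ ε ^ n * (t - s) ≤ helixMass r φ ε n s t ∧
      helixMass r φ ε n s t ≤ rateHi φ ε ^ n * (t - s) := by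
  induction n with
  | zero => simp [helixMass_zero]
  | succ n ih =>
    obtain ⟨h1, h2⟩ := h.helixMass_succ n hst
    have h3 := mul_le_mul_of_nonneg_left ih.1
      (by linarith [h.half_le_rateLo] : 0 ≤ rateLo φ ε)
    have h4 := mul_le_mul_of_nonneg_left ih.2 h.rateHi_pos.le
    rw [pow_succ', pow_succ', mul_assoc, mul_assoc]
    exact ⟨h3.trans h1, h2.trans h4⟩

theorem helixMass_nonneg (h : HelixParams r φ ε) (n : ℕ) {s t : ℝ} (hst : s ≤ t) :
    0 ≤ helixMass r φ ε n s t :=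
  le_trans (mul_nonneg (pow_nonneg (by linarith [h.half_le_rateLo]) n) (sub_nonneg.mpr hst))
    (h.helixMass_bounds n hst).1

theorem helixMass_pos (h : HelixParams r φ ε) (n : ℕ) {s t : ℝ} (hst : s < t) :
    0 < helixMass r φ ε n s t := by
  have := h.half_le_rateLo
  have := sub_pos.mpr hst
  exact lt_of_lt_of_le (by positivity) (h.helixMass_bounds n hst.le).1

theorem dist_helixSeq_succ (h : HelixParams r φ ε) (n : ℕ) (t : ℝ) :
    dist (helixSeq r φ ε n t) (helixSeq r φ ε (n + 1) t) ≤ 2 * (r / 50 ^ n) := by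
  rw [dist_comm, dist_def, helixSeq, helix, inv_mul_cancel_left]
  exact koranyi_circleStep_le (h.radius_pos n).le
    (by rcases h.orientation with rfl | rfl <;> norm_num) _

theorem dist_helixSeq (h : HelixParams r φ ε) {i j : ℕ} (hij : i ≤ j) (t : ℝ) :
    -- The geometric series has sum `2 * 50/49 < 3` times its first radius.
    dist (helixSeq r φ ε i t) (helixSeq r φ ε j t) ≤ 3 * (r / 50 ^ i) := by
  have key : dist (helixSeq r φ ε i t) (helixSeq r φ ε j t) ≤
      3 * (r / 50 ^ i) - 3 * (r / 50 ^ j) := by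
    induction j, hij using Nat.le_induction with
    | base => simp
    | succ j _ ih =>
      have e : r / 50 ^ (j + 1) = r / 50 ^ j / 50 := by rw [pow_succ, div_div]
      linarith [dist_triangle (helixSeq r φ ε i t) (helixSeq r φ ε j t)
        (helixSeq r φ ε (j + 1) t), h.dist_helixSeq_succ j t, h.radius_pos j]
  linarith [h.radius_pos j]

/-- One level at most doubles the mass and divides the squared radius by 2500, so mass at the first
resolved level cannot overshoot the threshold by more than 5000. -/
theorem helixMass_succ_le (h : HelixParams r φ ε) {K s t : ℝ} (hst : s ≤ t) {n : ℕ}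
    (hn : helixMass r φ ε n s t < K * (r / 50 ^ n) ^ 2) :
    helixMass r φ ε (n + 1) s t ≤ 5000 * K * (r / 50 ^ (n + 1)) ^ 2 := by
  have e : r / 50 ^ (n + 1) = r / 50 ^ n / 50 := by rw [pow_succ, div_div]
  have h0 := h.helixMass_nonneg n hst
  rw [e]
  nlinarith [(h.helixMass_succ n hst).2, h.rateHi_le_two]

/-- At scales above its radius, an iterated helix is nearly vertical. -/
theorem displacement (h : HelixParams r φ ε) {K s t : ℝ} (hst : s ≤ t) {i : ℕ}
    (hi : ∀ k < i, helixMass r φ ε k s t < K * (r / 50 ^ k) ^ 2) (hK : 0 < K) :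
    ((helixSeq r φ ε i s)⁻¹ * helixSeq r φ ε i t).x ^ 2
      + ((helixSeq r φ ε i s)⁻¹ * helixSeq r φ ε i t).y ^ 2
      ≤ 70 * ε ^ 2 * K * helixMass r φ ε i s t ∧
    |((helixSeq r φ ε i s)⁻¹ * helixSeq r φ ε i t).z - helixMass r φ ε i s t|
      ≤ 70 * ε ^ 2 * K * helixMass r φ ε i s t := by
  cases i with
  | zero =>
    have : 0 ≤ t - s := sub_nonneg.mpr hst
    have : 0 ≤ 70 * ε ^ 2 * K * (t - s) := by positivity
    rw [helixMass_zero]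
    simpa [helixSeq, neg_add_eq_sub] using this
  | succ n =>
    have hm := h.helixMass_succ_le hst (hi n n.lt_succ_self)
    obtain ⟨hx, hy, hz⟩ := (h.isTame (n + 1)).displacement hst
    have hR := h.radius_pos (n + 1)
    change |_| ≤ _ * helixMass r φ ε (n + 1) s t at hx hy
    change |_ - helixMass r φ ε (n + 1) s t| ≤ _ * helixMass r φ ε (n + 1) s t ^ 2 / 2 at hz
    have h0 := h.helixMass_nonneg (n + 1) hst
    set R := r / 50 ^ (n + 1)
    set m := helixMass r φ ε (n + 1) s t
    -- The constant is `5000 / 144 < 35`.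
    have key : (ε / (12 * R) * m) ^ 2 ≤ 35 * ε ^ 2 * K * m := by
      have e : (ε / (12 * R) * m) ^ 2 = ε ^ 2 / 144 / R ^ 2 * m * m := by field_simp; ring
      have e' : ε ^ 2 / 144 / R ^ 2 * m ≤ 35 * ε ^ 2 * K := by
        rw [div_mul_eq_mul_div, div_le_iff₀ (by positivity)]
        have := mul_le_mul_of_nonneg_left hm (by positivity : 0 ≤ ε ^ 2 / 144)
        have h3 : 0 ≤ ε ^ 2 * K * R ^ 2 := by positivity
        nlinarith
      rw [e]
      exact mul_le_mul_of_nonneg_right e' h0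
    rw [← mul_pow] at hz
    have hx2 := sq_le_sq' (abs_le.mp hx).1 (abs_le.mp hx).2
    have hy2 := sq_le_sq' (abs_le.mp hy).1 (abs_le.mp hy).2
    refine ⟨by linarith, hz.trans ?_⟩
    linarith [sq_nonneg (ε / (12 * R) * m)]

/-- The displacement of all later helices is nearly vertical once the scale has been resolved. -/
theorem displacement_of_le (h : HelixParams r φ ε) {K σ s t : ℝ} (hst : s ≤ t) {i j : ℕ}
    (hi : ∀ k < i, helixMass r φ ε k s t < K * (r / 50 ^ k) ^ 2) (hK : 0 < K)
    (hi' : K * (r / 50 ^ i) ^ 2 ≤ helixMass r φ ε i s t)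
    (hσ : 70 * ε ^ 2 * K ≤ σ / 6) (hσ' : 144 ≤ σ * K) (hij : i ≤ j) :
    ((helixSeq r φ ε j s)⁻¹ * helixSeq r φ ε j t).x ^ 2
      + ((helixSeq r φ ε j s)⁻¹ * helixSeq r φ ε j t).y ^ 2 ≤ σ * helixMass r φ ε i s t ∧
    |((helixSeq r φ ε j s)⁻¹ * helixSeq r φ ε j t).z - helixMass r φ ε i s t|
      ≤ σ * helixMass r φ ε i s t := by
  obtain ⟨h1, h2⟩ := h.displacement hst hi hK
  have hu := h.dist_helixSeq hij s
  have hv := h.dist_helixSeq hij t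
  rw [dist_comm, dist_def] at hu hv
  obtain ⟨h3, h4⟩ := translate_bounds hu hv h1 h2
  have e : ((helixSeq r φ ε i s)⁻¹ * helixSeq r φ ε j s)⁻¹
      * ((helixSeq r φ ε i s)⁻¹ * helixSeq r φ ε i t)
      * ((helixSeq r φ ε i t)⁻¹ * helixSeq r φ ε j t)
      = (helixSeq r φ ε j s)⁻¹ * helixSeq r φ ε j t := by group
  rw [e] at h3 h4
  have h0 : 0 ≤ helixMass r φ ε i s t := le_trans (by positivity) hi'
  -- Half of `σ` pays for the displacement at level `i`, the other half for the later helices.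
  have hb : 3 * (70 * ε ^ 2 * K * helixMass r φ ε i s t) + 72 * (r / 50 ^ i) ^ 2
      ≤ σ * helixMass r φ ε i s t := by
    have h5 := mul_le_mul_of_nonneg_right hσ h0
    have hσ0 : 0 ≤ σ := by nlinarith [sq_nonneg ε]
    have h6 := mul_le_mul_of_nonneg_left hi' hσ0
    have h7 := mul_le_mul_of_nonneg_right hσ' (sq_nonneg (r / 50 ^ i))
    linarith
  exact ⟨h3.trans hb, h4.trans hb⟩

/-- Every displacement is resolved at some scale. -/
theorem exists_resolved (h : HelixParams r φ ε) (K : ℝ) {s t : ℝ} (hst : s < t) :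
    ∃ i, K * (r / 50 ^ i) ^ 2 ≤ helixMass r φ ε i s t := by
  have hτ := sub_pos.mpr hst
  -- Mass loses at most a factor 2 per level and the squared radius a factor 2500; the quotient
  -- gains 1250.
  obtain ⟨i, hi⟩ := pow_unbounded_of_one_lt (K * r ^ 2 / (t - s)) (by norm_num : (1 : ℝ) < 1250)
  refine ⟨i, le_trans ?_ (h.helixMass_bounds i hst.le).1⟩
  rw [div_lt_iff₀ hτ] at hi
  have h1 : (1 / 2 : ℝ) ^ i ≤ rateLo φ ε ^ i := pow_le_pow_left₀ (by norm_num) h.half_le_rateLo i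
  have h2 := mul_le_mul_of_nonneg_right h1 hτ.le
  refine le_trans ?_ h2
  rw [div_pow, ← pow_mul, mul_comm i 2, pow_mul, mul_div_assoc', div_le_iff₀ (by positivity)]
  have e : (1 / 2 : ℝ) ^ i * (50 ^ 2) ^ i = 1250 ^ i := by rw [← mul_pow]; norm_num
  calc K * r ^ 2 ≤ 1250 ^ i * (t - s) := hi.le
    _ = (1 / 2) ^ i * (t - s) * (50 ^ 2) ^ i := by rw [← e]; ring

theorem mem_VCone_of_bounds {lam σ m : ℝ} {g : Heisenberg} (hm : 0 ≤ m) (hlam : 0 ≤ lam)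
    (hσ : σ ≤ 1 / 2) (hσ' : lam * σ ≤ 1 / 2) (h1 : g.x ^ 2 + g.y ^ 2 ≤ σ * m)
    (h2 : |g.z - m| ≤ σ * m) : g ∈ VCone lam := by
  have h3 := mul_le_mul_of_nonneg_left h1 hlam
  have h4 := (abs_le.mp h2).1
  have h5 := le_abs_self g.z
  change lam * (g.x ^ 2 + g.y ^ 2) ≤ |g.z|
  nlinarith

theorem isVerticalCurve (h : HelixParams r φ ε) {K σ lam : ℝ} (hK : 0 < K) (hlam : 0 ≤ lam)
    (hσ : 70 * ε ^ 2 * K ≤ σ / 6) (hσ' : 144 ≤ σ * K) (hσ₁ : σ ≤ 1 / 2) (hσ₂ : lam * σ ≤ 1 / 2)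
    (j : ℕ) (S : Set ℝ) : IsVerticalCurve lam (helixSeq r φ ε j '' S) := by
  classical
  refine isVerticalCurve_image_of_lt fun s _ t _ hst => ?_
  by_cases hj : ∃ i, i ≤ j ∧ K * (r / 50 ^ i) ^ 2 ≤ helixMass r φ ε i s t
  · obtain ⟨h1, h2⟩ := Nat.find_spec hj
    obtain ⟨h3, h4⟩ := h.displacement_of_le hst.le (fun k hk => lt_of_not_ge fun hk' =>
      Nat.find_min hj hk ⟨hk.le.trans h1, hk'⟩) hK h2 hσ hσ' h1
    exact mem_VCone_of_bounds (h.helixMass_pos _ hst).le hlam hσ₁ hσ₂ h3 h4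
  -- No level up to `j` is resolved, so the estimate at level `j` itself applies and no later helix
  -- intervenes.
  · push Not at hj
    obtain ⟨h3, h4⟩ := h.displacement hst.le (fun k hk => hj k hk.le) hK
    have hm := h.helixMass_pos j hst
    have h5 : 70 * ε ^ 2 * K ≤ σ := by nlinarith [sq_nonneg ε]
    have h6 := mul_le_mul_of_nonneg_right h5 hm.le
    exact mem_VCone_of_bounds hm.le hlam hσ₁ hσ₂ (h3.trans h6) (h4.trans h6)

end HelixParams

/-! ### The limit curve -/

/-- The limit of the iterated helices. -/
def helixLimit (r φ ε t : ℝ) : Heisenberg :=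
  haveI : Nonempty Heisenberg := ⟨1⟩
  limUnder atTop fun n => helixSeq r φ ε n t

namespace HelixParams

variable {r φ ε : ℝ}

theorem tendsto_helixLimit (h : HelixParams r φ ε) (t : ℝ) :
    Tendsto (fun n => helixSeq r φ ε n t) atTop (𝓝 (helixLimit r φ ε t)) := by
  refine (cauchySeq_of_le_geometric (1 / 50) (2 * r) (by norm_num) fun n => ?_).tendsto_limUnder
  refine (h.dist_helixSeq_succ n t).trans (le_of_eq ?_)
  rw [one_div, inv_pow]
  ring

theorem tendsto_radius (r : ℝ) : Tendsto (fun n : ℕ => r / 50 ^ n) atTop (𝓝 0) :=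
  tendsto_const_nhds.div_atTop (tendsto_pow_atTop_atTop_of_one_lt (by norm_num))

theorem tendstoUniformlyOn (h : HelixParams r φ ε) (S : Set ℝ) :
    TendstoUniformlyOn (helixSeq r φ ε) (helixLimit r φ ε) atTop S := by
  rw [Metric.tendstoUniformlyOn_iff]
  intro δ hδ
  have hr : Tendsto (fun n : ℕ => 3 * (r / 50 ^ n)) atTop (𝓝 0) := by
    simpa using (tendsto_radius r).const_mul 3
  filter_upwards [hr.eventually (gt_mem_nhds hδ)] with n hn t _
  refine lt_of_le_of_lt ?_ hn
  rw [dist_comm]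
  refine le_of_tendsto (tendsto_const_nhds.dist (h.tendsto_helixLimit t)) ?_
  filter_upwards [eventually_ge_atTop n] with j hj
  exact h.dist_helixSeq hj t

theorem isHelicalLimit (h : HelixParams r φ ε) {lam : ℝ}
    (hv : ∀ j, IsVerticalCurve lam (helixSeq r φ ε j '' Icc 0 1)) :
    IsHelicalLimit lam φ (helixLimit r φ ε) :=
  ⟨helixSeq r φ ε, fun n => r / 50 ^ n, fun i => (h.isTame i).smooth,
    fun i t _ => (h.isTame i).speed_pos t, hv, h.radius_pos,
    strictAnti_nat_of_succ_lt fun n => by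
      rw [pow_succ, ← div_div]
      exact div_lt_self (h.radius_pos n) (by norm_num),
    tendsto_radius r,
    fun i => (h.isTame i).isHelicalPerturbation_helix (h.radius_pos i) h.ε_pos φ,
    h.tendstoUniformlyOn _⟩

theorem isVerticalCurve_helixLimit (h : HelixParams r φ ε) {lam : ℝ} {S : Set ℝ}
    (hv : ∀ j, IsVerticalCurve lam (helixSeq r φ ε j '' S)) :
    IsVerticalCurve lam (helixLimit r φ ε '' S) :=
  isVerticalCurve_image_of_lt fun s hs t ht _ =>
    (isClosed_VCone lam).mem_of_tendsto
      (tendsto_inv_mul (h.tendsto_helixLimit s) (h.tendsto_helixLimit t))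
      (.of_forall fun j => isVerticalCurve_iff.mp (hv j) _ ⟨s, hs, rfl⟩ _ ⟨t, ht, rfl⟩)

/-- With `σ ≤ 1/2`, the central coordinate lies between `m/2` and `3m/2` and the squared horizontal
part is at most `m/2`; the bounds are uniform in later levels and pass to the limit. -/
theorem dist_helixLimit_sq (h : HelixParams r φ ε) {K σ s t : ℝ} (hst : s ≤ t) {i : ℕ}
    (hi : ∀ k < i, helixMass r φ ε k s t < K * (r / 50 ^ k) ^ 2) (hK : 0 < K)
    (hi' : K * (r / 50 ^ i) ^ 2 ≤ helixMass r φ ε i s t)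
    (hσ : 70 * ε ^ 2 * K ≤ σ / 6) (hσ' : 144 ≤ σ * K) (hσ₁ : σ ≤ 1 / 2) :
    2 * helixMass r φ ε i s t ≤ dist (helixLimit r φ ε s) (helixLimit r φ ε t) ^ 2 ∧
      dist (helixLimit r φ ε s) (helixLimit r φ ε t) ^ 2 ≤ 7 * helixMass r φ ε i s t := by
  have hm : 0 ≤ helixMass r φ ε i s t := le_trans (by positivity) hi'
  have key : ∀ j, i ≤ j →
      2 * helixMass r φ ε i s t ≤ dist (helixSeq r φ ε j s) (helixSeq r φ ε j t) ^ 2 ∧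
      dist (helixSeq r φ ε j s) (helixSeq r φ ε j t) ^ 2 ≤ 7 * helixMass r φ ε i s t := by
    intro j hj
    obtain ⟨h1, h2⟩ := h.displacement_of_le hst hi hK hi' hσ hσ' hj
    rw [dist_comm, dist_def]
    set g := (helixSeq r φ ε j s)⁻¹ * helixSeq r φ ε j t
    have h3 := four_mul_abs_z_le_koranyi_sq g
    have h4 := koranyi_sq_le g
    have h5 := mul_le_mul_of_nonneg_right hσ₁ hm
    rw [abs_le] at h2
    have h6 : |g.z| ≤ 3 / 2 * helixMass r φ ε i s t := abs_le.mpr ⟨by linarith, by linarith⟩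
    have h7 := le_abs_self g.z
    constructor <;> linarith
  have ht := ((h.tendsto_helixLimit s).dist (h.tendsto_helixLimit t)).pow 2
  constructor
  · refine ge_of_tendsto ht ?_
    filter_upwards [eventually_ge_atTop i] with j hj using (key j hj).1
  · refine le_of_tendsto ht ?_
    filter_upwards [eventually_ge_atTop i] with j hj using (key j hj).2

end HelixParams

/-! ### Hausdorff dimension from bi-Hölder bounds -/

namespace IsBiHolder

variable {a b : ℝ} {γ : ℝ → Heisenberg}

theorem of_lt {A B : ℝ} (hA : 0 < A) (hB : 0 < B) (ha : 0 < a) (hb : 0 < b)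
    (h : ∀ s ∈ Icc (0 : ℝ) 1, ∀ t ∈ Icc (0 : ℝ) 1, s < t →
      B * (t - s) ^ b ≤ dist (γ s) (γ t) ∧ dist (γ s) (γ t) ≤ A * (t - s) ^ a) :
    IsBiHolder a b γ := by
  have key : ∀ s ∈ Icc (0 : ℝ) 1, ∀ t ∈ Icc (0 : ℝ) 1, s < t →
      (max A B⁻¹)⁻¹ * (t - s) ^ b ≤ dist (γ s) (γ t) ∧
      dist (γ s) (γ t) ≤ max A B⁻¹ * (t - s) ^ a := by
    intro s hs t ht hst
    obtain ⟨h1, h2⟩ := h s hs t ht hst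
    have hτ := sub_pos.mpr hst
    refine ⟨le_trans ?_ h1, h2.trans ?_⟩
    · gcongr
      exact inv_le_of_inv_le₀ hB (le_max_right _ _)
    · gcongr
      exact le_max_left _ _
  refine ⟨max A B⁻¹, lt_max_of_lt_left hA, fun s hs t ht => ?_⟩
  rcases lt_trichotomy s t with hst | rfl | hst
  · rw [abs_sub_comm, abs_of_pos (sub_pos.mpr hst)]
    exact key s hs t ht hst
  · simp [Real.zero_rpow ha.ne', Real.zero_rpow hb.ne']
  · rw [abs_of_pos (sub_pos.mpr hst), dist_comm]
    exact key t ht s hs hst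

theorem holderOnWith (h : IsBiHolder a b γ) (ha : 0 < a) :
    ∃ C : NNReal, HolderOnWith C (.mk a ha.le) γ (Icc 0 1) := by
  obtain ⟨C, hC, h⟩ := h
  refine ⟨.mk C hC.le, fun s hs t ht => ?_⟩
  have h1 := (h s hs t ht).2
  rw [← Real.dist_eq] at h1
  rw [edist_dist, edist_dist, NNReal.coe_mk, ENNReal.ofReal_rpow_of_nonneg dist_nonneg ha.le,
    ← ENNReal.ofReal_coe_nnreal, NNReal.coe_mk, ← ENNReal.ofReal_mul hC.le]
  exact ENNReal.ofReal_le_ofReal h1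

theorem dimH_le (h : IsBiHolder a b γ) (ha : 0 < a) :
    dimH (γ '' Icc 0 1) ≤ ENNReal.ofReal a⁻¹ := by
  obtain ⟨C, hC⟩ := h.holderOnWith ha
  refine (hC.dimH_image_le ha).trans ?_
  have h1 : dimH (Icc (0 : ℝ) 1) ≤ 1 := (dimH_mono (subset_univ _)).trans_eq Real.dimH_univ
  calc _ ≤ 1 / ENNReal.ofNNReal (.mk a ha.le) := ENNReal.div_le_div_right h1 _
    _ = ENNReal.ofReal a⁻¹ := by
      rw [one_div, ENNReal.ofReal_inv_of_pos ha, ENNReal.ofReal_eq_coe_nnreal ha.le]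

/-- The lower bound makes `γ` injective with a `b⁻¹`-Hölder inverse, which maps the image onto an
interval of dimension 1. -/
theorem le_dimH (h : IsBiHolder a b γ) (hb : 0 < b) :
    ENNReal.ofReal b⁻¹ ≤ dimH (γ '' Icc 0 1) := by
  obtain ⟨C, hC, h⟩ := h
  have hlow : ∀ s ∈ Icc (0 : ℝ) 1, ∀ t ∈ Icc (0 : ℝ) 1,
      |s - t| ≤ C ^ b⁻¹ * dist (γ s) (γ t) ^ b⁻¹ := by
    intro s hs t ht
    have h1 := (h s hs t ht).1
    rw [inv_mul_le_iff₀ hC] at h1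
    rw [← Real.mul_rpow hC.le dist_nonneg]
    exact (Real.le_rpow_inv_iff_of_pos (abs_nonneg _) (by positivity) hb).mpr h1
  set g := Function.invFunOn γ (Icc 0 1)
  have hinj : InjOn γ (Icc 0 1) := by
    intro s hs t ht hst
    have := hlow s hs t ht
    rw [hst, dist_self, Real.zero_rpow (inv_pos.mpr hb).ne', mul_zero] at this
    exact sub_eq_zero.mp (abs_nonpos_iff.mp this)
  have hg : ∀ s ∈ Icc (0 : ℝ) 1, g (γ s) = s := hinj.leftInvOn_invFunOn
  have hH : HolderOnWith (.mk (C ^ b⁻¹) (by positivity)) (.mk b⁻¹ (by positivity)) g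
      (γ '' Icc 0 1) := by
    rintro _ ⟨s, hs, rfl⟩ _ ⟨t, ht, rfl⟩
    rw [hg s hs, hg t ht, edist_dist, edist_dist, NNReal.coe_mk,
      ENNReal.ofReal_rpow_of_nonneg dist_nonneg (by positivity),
      ← ENNReal.ofReal_coe_nnreal, ← ENNReal.ofReal_mul (by positivity), Real.dist_eq]
    exact ENNReal.ofReal_le_ofReal (hlow s hs t ht)
  have hpos : (0 : NNReal) < .mk b⁻¹ (by positivity) := inv_pos.mpr hb
  have h1 := hH.dimH_image_le hpos
  have himg : g '' (γ '' Icc 0 1) = Icc 0 1 := hinj.invFunOn_image Subset.rfl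
  rw [himg, Real.dimH_of_nonempty_interior (by simp), Module.finrank_self, Nat.cast_one] at h1
  have h2 := ENNReal.mul_le_of_le_div h1
  rwa [one_mul, ← ENNReal.ofReal_eq_coe_nnreal (inv_nonneg.mpr hb.le)] at h2

theorem isConnected_image (h : IsBiHolder a b γ) (ha : 0 < a) : IsConnected (γ '' Icc 0 1) := by
  obtain ⟨C, hC⟩ := h.holderOnWith ha
  exact (isConnected_Icc zero_le_one).image _ (hC.continuousOn ha)

end IsBiHolder

/-! ### Exponents -/

/-- The exponent `a` for which `(2500 q) ^ a = 50`. -/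
def scaleExponent (q : ℝ) : ℝ := Real.log 50 / Real.log (2500 * q)

theorem one_lt_mul_of_half_le {q : ℝ} (hq : 1 / 2 ≤ q) : 1 < 2500 * q := by linarith

theorem scaleExponent_pos {q : ℝ} (hq : 1 / 2 ≤ q) : 0 < scaleExponent q :=
  div_pos (Real.log_pos (by norm_num)) (Real.log_pos (one_lt_mul_of_half_le hq))

theorem rpow_scaleExponent {q : ℝ} (hq : 1 / 2 ≤ q) : (2500 * q) ^ scaleExponent q = 50 := by
  have h1 := one_lt_mul_of_half_le hq
  rw [Real.rpow_def_of_pos (by linarith), scaleExponent, mul_div_cancel₀ _ (Real.log_pos h1).ne',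
    Real.exp_log (by norm_num)]

theorem inv_pow_rpow_scaleExponent {q : ℝ} (hq : 1 / 2 ≤ q) (i : ℕ) :
    (1 / (2500 * q) ^ i) ^ scaleExponent q = 1 / 50 ^ i := by
  have h1 := one_lt_mul_of_half_le hq
  have h0 : 0 ≤ 2500 * q := by linarith
  rw [Real.div_rpow zero_le_one (by positivity), Real.one_rpow, ← Real.rpow_pow_comm h0,
    rpow_scaleExponent hq]

theorem scaleExponent_anti {p q : ℝ} (hp : 1 / 2 ≤ p) (hpq : p ≤ q) :
    scaleExponent q ≤ scaleExponent p :=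
  div_le_div_of_nonneg_left (Real.log_nonneg (by norm_num))
    (Real.log_pos (one_lt_mul_of_half_le hp)) (Real.log_le_log (by linarith) (by linarith))

theorem log_2500 : Real.log 2500 = 2 * Real.log 50 := by
  rw [show (2500 : ℝ) = 50 ^ 2 by norm_num, Real.log_pow]
  norm_num

theorem half_lt_scaleExponent {q : ℝ} (hq : 1 / 2 ≤ q) (hq' : q < 1) : 1 / 2 < scaleExponent q := by
  rw [scaleExponent, lt_div_iff₀ (Real.log_pos (one_lt_mul_of_half_le hq))]
  have := Real.log_lt_log (by linarith) (by linarith : 2500 * q < 2500)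
  rw [log_2500] at this
  linarith

theorem scaleExponent_lt_half {q : ℝ} (hq : 1 < q) : scaleExponent q < 1 / 2 := by
  rw [scaleExponent, div_lt_iff₀ (Real.log_pos (by linarith))]
  have := Real.log_lt_log (by norm_num) (by linarith : 2500 < 2500 * q)
  rw [log_2500] at this
  linarith

theorem scaleExponent_lt_one {q : ℝ} (hq : 1 / 2 ≤ q) : scaleExponent q < 1 := by
  rw [scaleExponent, div_lt_one (Real.log_pos (one_lt_mul_of_half_le hq))]
  exact Real.log_lt_log (by norm_num) (by linarith)

/-! ### Bi-Hölder bounds for the limit -/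

namespace HelixParams

variable {r φ ε : ℝ}

/-- A displacement resolved at scale `i` has size comparable to `50⁻ⁱ`. -/
theorem exists_scale (h : HelixParams r φ ε) {K σ : ℝ} (hK : 0 < K)
    (hσ : 70 * ε ^ 2 * K ≤ σ / 6) (hσ' : 144 ≤ σ * K) (hσ₁ : σ ≤ 1 / 2) {s t : ℝ} (hst : s < t)
    (hst' : t - s ≤ 1) : ∃ i : ℕ,
      √(2 * K) * r * (1 / 50 ^ i) ≤ dist (helixLimit r φ ε s) (helixLimit r φ ε t) ∧
      dist (helixLimit r φ ε s) (helixLimit r φ ε t) ≤ √(35000 * K * r ^ 2 + 7) * (1 / 50 ^ i) ∧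
      K * r ^ 2 * (1 / (2500 * rateHi φ ε) ^ i) ≤ t - s ∧
      t - s ≤ (5000 * K * r ^ 2 + 1) * (1 / (2500 * rateLo φ ε) ^ i) := by
  classical
  have hex := h.exists_resolved K hst
  obtain ⟨i, hi', hi⟩ : ∃ i, K * (r / 50 ^ i) ^ 2 ≤ helixMass r φ ε i s t ∧
      ∀ k < i, helixMass r φ ε k s t < K * (r / 50 ^ k) ^ 2 :=
    ⟨Nat.find hex, Nat.find_spec hex, fun k hk => lt_of_not_ge (Nat.find_min hex hk)⟩
  have hr := h.r_pos
  have hτ := sub_pos.mpr hst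
  have hlo : 0 < rateLo φ ε := by linarith [h.half_le_rateLo]
  have hhi := h.rateHi_pos
  have e50 : ((50 : ℝ) ^ i) ^ 2 = 2500 ^ i := by rw [← pow_mul, mul_comm, pow_mul]; norm_num
  have hupper : helixMass r φ ε i s t ≤ (5000 * K * r ^ 2 + 1) * (1 / 2500 ^ i) := by
    cases i with
    -- At level 0 there is no unresolved predecessor; `t - s ≤ 1` accounts for the summand 1.
    | zero => rw [helixMass_zero]; simp; nlinarith [mul_pos hK (sq_pos_of_pos hr)]
    | succ n =>
      refine (h.helixMass_succ_le hst.le (hi n n.lt_succ_self)).trans ?_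
      rw [div_pow, e50, mul_one_div, mul_div_assoc']
      gcongr
      linarith
  obtain ⟨h1, h2⟩ := h.dist_helixLimit_sq hst.le hi hK hi' hσ hσ' hσ₁
  obtain ⟨h3, h4⟩ := h.helixMass_bounds i hst.le
  refine ⟨i, ?_, ?_, ?_, ?_⟩
  · refine le_of_sq_le_sq (le_trans (le_of_eq ?_) ((mul_le_mul_of_nonneg_left hi'
      zero_le_two).trans h1)) dist_nonneg
    rw [mul_pow, mul_pow, Real.sq_sqrt (by positivity), div_pow, div_pow]
    ring
  · refine le_of_sq_le_sq (h2.trans ?_) (by positivity)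
    rw [mul_pow, Real.sq_sqrt (by positivity), div_pow, e50, one_pow]
    linarith
  · rw [mul_one_div, mul_pow, div_le_iff₀ (by positivity)]
    have := hi'.trans h4
    rw [div_pow, e50, mul_div_assoc', div_le_iff₀ (by positivity)] at this
    linarith
  · rw [mul_one_div, mul_pow, le_div_iff₀ (by positivity)]
    have := h3.trans hupper
    rw [mul_one_div, le_div_iff₀ (by positivity)] at this
    linarith

/-- The exponents turn `(2500 q) ^ (-i)` into `50 ^ (-i)`, which eliminates the scale `i`. -/
theorem isBiHolder (h : HelixParams r φ ε) {K σ : ℝ} (hK : 0 < K)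
    (hσ : 70 * ε ^ 2 * K ≤ σ / 6) (hσ' : 144 ≤ σ * K) (hσ₁ : σ ≤ 1 / 2) :
    IsBiHolder (scaleExponent (rateHi φ ε)) (scaleExponent (rateLo φ ε)) (helixLimit r φ ε) := by
  have hr := h.r_pos
  have hlo := h.half_le_rateLo
  have hhi := hlo.trans h.rateLo_le_rateHi
  have ha := scaleExponent_pos hhi
  have hb := scaleExponent_pos hlo
  have hlo0 : 0 < rateLo φ ε := by linarith
  have hhi0 := h.rateHi_pos
  refine .of_lt (A := √(35000 * K * r ^ 2 + 7) / (K * r ^ 2) ^ scaleExponent (rateHi φ ε))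
    (B := √(2 * K) * r / (5000 * K * r ^ 2 + 1) ^ scaleExponent (rateLo φ ε))
    (by positivity) (by positivity) ha hb fun s hs t ht hst => ?_
  have hτ := sub_pos.mpr hst
  obtain ⟨i, h1, h2, h3, h4⟩ := h.exists_scale hK hσ hσ' hσ₁ hst (by linarith [hs.1, ht.2])
  have h5 := Real.rpow_le_rpow (by positivity) h3 ha.le
  have h6 := Real.rpow_le_rpow hτ.le h4 hb.le
  rw [Real.mul_rpow (by positivity) (by positivity), inv_pow_rpow_scaleExponent hhi] at h5
  rw [Real.mul_rpow (by positivity) (by positivity), inv_pow_rpow_scaleExponent hlo] at h6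
  constructor
  · refine le_trans ?_ h1
    rw [div_mul_eq_mul_div, div_le_iff₀ (by positivity)]
    calc _ ≤ √(2 * K) * r * _ := mul_le_mul_of_nonneg_left h6 (by positivity)
      _ = _ := by ring
  · refine h2.trans ?_
    rw [div_mul_eq_mul_div, le_div_iff₀ (by positivity)]
    calc _ = √(35000 * K * r ^ 2 + 7) *
          ((K * r ^ 2) ^ scaleExponent (rateHi φ ε) * (1 / 50 ^ i)) := by
          ring
      _ ≤ _ := mul_le_mul_of_nonneg_left h5 (by positivity)

end HelixParams

/-! ### Choice of parameters and conclusion -/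

theorem exists_helicalLimit {lam φ : ℝ} (hlam : 0 < lam) (hφ : φ = 1 ∨ φ = -1) :
    ∃ (γ : ℝ → Heisenberg) (ε : ℝ), 0 < ε ∧ 1 / 2 ≤ rateLo φ ε ∧ rateLo φ ε ≤ rateHi φ ε ∧
      IsHelicalLimit lam φ γ ∧ IsVerticalCurve lam (γ '' Icc 0 1) ∧
      IsBiHolder (scaleExponent (rateHi φ ε)) (scaleExponent (rateLo φ ε)) γ := by
  obtain ⟨σ, hσ0, hσ₁, hσ₂⟩ : ∃ σ : ℝ, 0 < σ ∧ σ ≤ 1 / 2 ∧ lam * σ ≤ 1 / 2 := by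
    refine ⟨1 / (2 * (1 + lam)), by positivity, ?_, ?_⟩
    · rw [div_le_div_iff₀ (by positivity) (by positivity)]; linarith
    · rw [mul_one_div, div_le_div_iff₀ (by positivity) (by positivity)]; linarith
  -- `K = 144/σ` is the least value allowed; then `ε = σ/250` works because `70 * 144 / 62500 <
  -- 1/6`.
  have hσ' : 144 ≤ σ * (144 / σ) := by field_simp; norm_num
  have hσ : 70 * (σ / 250) ^ 2 * (144 / σ) ≤ σ / 6 := by
    have e : 70 * (σ / 250) ^ 2 * (144 / σ) = 70 * 144 / 62500 * σ := by field_simp; norm_num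
    rw [e]
    linarith
  have h : HelixParams (σ / 2500) φ (σ / 250) :=
    ⟨by positivity, hφ, by positivity, by linarith, by nlinarith⟩
  have hK : 0 < 144 / σ := by positivity
  have hv := fun j => h.isVerticalCurve hK hlam.le hσ hσ' hσ₁ hσ₂ j (Icc 0 1)
  exact ⟨helixLimit (σ / 2500) φ (σ / 250), σ / 250, by positivity, h.half_le_rateLo,
    h.rateLo_le_rateHi, h.isHelicalLimit hv, h.isVerticalCurve_helixLimit hv,
    h.isBiHolder hK hσ hσ' hσ₁⟩

end Heisenberg

end

theorem theorem1p3 (lam : ℝ) (hlam : 0 < lam) :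
    ∃ E E' : Set Heisenberg,
      IsConnected E ∧ Heisenberg.IsVerticalCurve lam E ∧
      IsConnected E' ∧ Heisenberg.IsVerticalCurve lam E' ∧
      dimH E < 2 ∧ 2 < dimH E' ∧
      (∃ γ : ℝ → Heisenberg, E = γ '' Icc (0 : ℝ) 1 ∧
        Heisenberg.IsHelicalLimit lam (-1) γ ∧
        ∃ a b : ℝ, 1 / 2 < a ∧ a ≤ b ∧ b < 1 ∧ Heisenberg.IsBiHolder a b γ) ∧
      (∃ γ' : ℝ → Heisenberg, E' = γ' '' Icc (0 : ℝ) 1 ∧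
        Heisenberg.IsHelicalLimit lam 1 γ' ∧
        ∃ a' b' : ℝ, 0 < a' ∧ a' ≤ b' ∧ b' < 1 / 2 ∧ Heisenberg.IsBiHolder a' b' γ') := by
  obtain ⟨γ, ε, hε, hlo, hle, hlim, hv, hh⟩ := Heisenberg.exists_helicalLimit hlam (Or.inr rfl)
  obtain ⟨γ', ε', hε', hlo', hle', hlim', hv', hh'⟩ :=
    Heisenberg.exists_helicalLimit hlam (Or.inl rfl)
  have hhi := hlo.trans hle
  have hhi' := hlo'.trans hle'
  -- For `φ = -1` the greatest factor is `1 - ε/4 < 1`; for `φ = 1` the least is `1 + ε'/4 > 1`.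
  have ha := Heisenberg.half_lt_scaleExponent hhi (by unfold Heisenberg.rateHi; linarith)
  have hb' := Heisenberg.scaleExponent_lt_half (q := Heisenberg.rateLo 1 ε')
    (by unfold Heisenberg.rateLo; linarith)
  refine ⟨γ '' Icc 0 1, γ' '' Icc 0 1, hh.isConnected_image (Heisenberg.scaleExponent_pos hhi), hv,
    hh'.isConnected_image (Heisenberg.scaleExponent_pos hhi'), hv', ?_, ?_,
    ⟨γ, rfl, hlim, _, _, ha, Heisenberg.scaleExponent_anti hlo hle,
      Heisenberg.scaleExponent_lt_one hlo, hh⟩,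
    ⟨γ', rfl, hlim', _, _, Heisenberg.scaleExponent_pos hhi',
      Heisenberg.scaleExponent_anti hlo' hle', hb', hh'⟩⟩
  · refine (hh.dimH_le (Heisenberg.scaleExponent_pos hhi)).trans_lt ?_
    rw [← ENNReal.ofReal_ofNat, ENNReal.ofReal_lt_ofReal_iff two_pos]
    exact inv_lt_of_inv_lt₀ two_pos (by simpa using ha)
  · refine lt_of_lt_of_le ?_ (hh'.le_dimH (Heisenberg.scaleExponent_pos hlo'))
    have h0 := Heisenberg.scaleExponent_pos hlo'
    rw [← ENNReal.ofReal_ofNat, ENNReal.ofReal_lt_ofReal_iff (by positivity)]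
    exact lt_inv_of_lt_inv₀ h0 (by simpa using hb')
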